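/- **Setting.** Consider $N$ agents on a connected undirected weighted graph, with a decision variable in $\mathbb R^n$. Let $K\in\mathbb R^{N\times N}$ be the network matrix: $K=K^\top$, $\mathbf 1^\top K=0$, $\rho(K)<1$, and for $i\ne j$ one has $K_{ij}\neq 0$ exactly when $i$ and $j$ are adjacent. Let $Q_1,\dots,Q_N\succeq 0$ be $n\times n$ matrices, $Q=\mathrm{diag}(Q_1,\dots,Q_N)$, $\alpha>0$ a step size, $a$ the attacked agent, $m$ the monitored agent, $w\in[0,1]^n$ and $\epsilon>0$. With state $\bar x=(x,z)\in\mathbb R^{nN}\times\mathbb R^{nN}$, the Wang–Elia closed loop from the attack to the two outputs is given by $$\bar A=\begin{bmatrix} I-K\otimes I_n-\alpha Q & -K\otimes I_n\\ K\otimes I_n & I\end{bmatrix},\qquad \bar B=\begin{bmatrix} e_a\otimes I_n\\ e_a\otimes I_n\end{bmatrix},$$ $\bar C_m\bar x=\big(\mathrm{diag}(1-w_i)\,x_m,\ \mathrm{diag}(w_i)\,z_m\big)$ and $\bar C_p\bar x=(x_i-x_{i+1})_{i=1}^{N-1}$. Put $\bar\Sigma_m=(\bar A,\bar B,\bar C_m,0)$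 and $\bar\Sigma_p=(\bar A,\bar B,\bar C_p,0)$. An (invariant) zero of $(A,B,C,0)$ is a $\lambda\in\mathbb C$ for which $\begin{bmatrix}\lambda I-A&B\\ C&0\end{bmatrix}\begin{bmatrix}x_0\\ g\end{bmatrix}=0$ for some complex $(x_0,g)\ne(0,0)$; it is unstable if $|\lambda|>1$. The relative degree is $\delta=1+\min\{j\ge0: CA^jB\ne0\}$; write $\delta_m,\delta_p$ for those of $\bar\Sigma_m,\bar\Sigma_p$, and let $d=\delta_m-\delta_p$. Let $\tilde A,\tilde B,\tilde C_p,\tilde C_m$ be the matrices of the augmented system with state $\tilde x[k]=(\bar x[k],\bar x[k-1],\dots,\bar x[k-d])$, in which the performance output is delayed by $d$ steps: $\tilde C_p\tilde x[k]=\bar C_p\bar x[k-d]$ and $\tilde C_m\tilde x[k]=\bar C_m\bar x[k]$. **Theorem.** Suppose that $\bar\Sigma_m$ has exactly one unstable zero $\lambda_m$ and all its other zeros satisfy $|\lambda|<1$; that $\bar\Sigma_p$ has exactly one unstable zero $\lambda_p$ (all its other zeros satisfy $|\lambda|\le 1$); and that $|\lambda_m|\neq|\lambda_p|$. Then the semidefinite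 program $$\inf_{\gamma,P}\ \epsilon\gamma\quad\text{s.t.}\quad \begin{bmatrix}\tilde A^\top P\tilde A-P+\tilde C_p^\top\tilde C_p-\gamma\,\tilde C_m^\top\tilde C_m&\tilde A^\top P\tilde B\\ \tilde B^\top P\tilde A&\tilde B^\top P\tilde B\end{bmatrix}\preceq0,\quad \gamma\ge0,\quad P=P^\top,$$ in which $P$ is only required to be symmetric and not positive semidefinite, has a bounded (finite) value. -/

import Mathlib

open scoped Matrix Kronecker

noncomputable section

section LinearSystems

/-! Strictly proper discrete-time systems `Σ = (A, B, C, 0)`. -/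

/-- The (Rosenbrock) system matrix `[λI - A, B; C, 0]` over `ℂ`. -/
def systemPencil {σ ι o : Type*} [DecidableEq σ]
    (A : Matrix σ σ ℝ) (B : Matrix σ ι ℝ) (C : Matrix o σ ℝ) (lam : ℂ) :
    Matrix (σ ⊕ o) (σ ⊕ ι) ℂ :=
  Matrix.fromBlocks (lam • (1 : Matrix σ σ ℂ) - A.map Complex.ofReal) (B.map Complex.ofReal)
    (C.map Complex.ofReal) 0

/-- `λ` is an invariant zero of `(A, B, C, 0)`: some nonzero vector `(x₀, g)` is in the kernel of
the system matrix. -/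
def IsInvariantZero {σ ι o : Type*} [Fintype σ] [DecidableEq σ] [Fintype ι]
    (A : Matrix σ σ ℝ) (B : Matrix σ ι ℝ) (C : Matrix o σ ℝ) (lam : ℂ) : Prop :=
  ∃ v : σ ⊕ ι → ℂ, v ≠ 0 ∧ systemPencil A B C lam *ᵥ v = 0

/-- The relative degree `1 + min {j ≥ 0 | C A ^ j B ≠ 0}`. -/
def relativeDegree {σ ι o : Type*} [Fintype σ] [DecidableEq σ]
    (A : Matrix σ σ ℝ) (B : Matrix σ ι ℝ) (C : Matrix o σ ℝ) : ℕ :=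
  1 + sInf {j : ℕ | C * A ^ j * B ≠ 0}

/-! The augmented system whose state is `(x[k], x[k-1], …, x[k-d])`. -/

/-- State matrix: block `0` evolves by `A`, block `i + 1` copies the previous block `i`. -/
def delayA {σ : Type*} [DecidableEq σ] (d : ℕ) (A : Matrix σ σ ℝ) :
    Matrix (Fin (d + 1) × σ) (Fin (d + 1) × σ) ℝ :=
  Matrix.of fun p q =>
    if p.1 = 0 then (if q.1 = 0 then A p.2 q.2 else 0)
    else if (q.1 : ℕ) + 1 = (p.1 : ℕ) ∧ p.2 = q.2 then 1 else 0

/-- Input matrix: the input enters block `0` through `B`. -/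
def delayB {σ ι : Type*} (d : ℕ) (B : Matrix σ ι ℝ) : Matrix (Fin (d + 1) × σ) ι ℝ :=
  Matrix.of fun p u => if p.1 = 0 then B p.2 u else 0

/-- Undelayed output `C x[k]`. -/
def currentC {σ o : Type*} (d : ℕ) (C : Matrix o σ ℝ) : Matrix o (Fin (d + 1) × σ) ℝ :=
  Matrix.of fun y q => if q.1 = 0 then C y q.2 else 0

/-- Delayed output `C x[k-d]`. -/
def delayC {σ o : Type*} (d : ℕ) (C : Matrix o σ ℝ) : Matrix o (Fin (d + 1) × σ) ℝ :=
  Matrix.of fun y q => if q.1 = Fin.last d then C y q.2 else 0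

/-- The matrix `[R, AᵀPB; BᵀPA, BᵀPB]` with `R = AᵀPA - P + CpᵀCp - γ CmᵀCm`. -/
def dissipationMatrix {σ ι o₁ o₂ : Type*} [Fintype σ] [Fintype o₁] [Fintype o₂]
    (A : Matrix σ σ ℝ) (B : Matrix σ ι ℝ) (Cp : Matrix o₁ σ ℝ) (Cm : Matrix o₂ σ ℝ)
    (γ : ℝ) (P : Matrix σ σ ℝ) : Matrix (σ ⊕ ι) (σ ⊕ ι) ℝ :=
  Matrix.fromBlocks (Aᵀ * P * A - P + Cpᵀ * Cp - γ • (Cmᵀ * Cm)) (Aᵀ * P * B)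
    (Bᵀ * P * A) (Bᵀ * P * B)

/-- Value in `[-∞, ∞]` of the SDP: the infimum of `ε γ` over all `γ ≥ 0` and all symmetric `P`
(no definiteness is required of `P`) for which the dissipation matrix is negative semidefinite.
It is `⊤` when the SDP is infeasible. -/
def sdpValue {σ ι o₁ o₂ : Type*} [Fintype σ] [Fintype o₁] [Fintype o₂]
    (A : Matrix σ σ ℝ) (B : Matrix σ ι ℝ) (Cp : Matrix o₁ σ ℝ) (Cm : Matrix o₂ σ ℝ)
    (ε : ℝ) : EReal :=
  sInf {v : EReal | ∃ (γ : ℝ) (P : Matrix σ σ ℝ), 0 ≤ γ ∧ P.IsSymm ∧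
    (-(dissipationMatrix A B Cp Cm γ P)).PosSemidef ∧ v = ((ε * γ : ℝ) : EReal)}

end LinearSystems

section WangElia

/-! The Wang–Elia algorithm with `N` agents, decision variable in `ℝⁿ`; the state is the pair of
stacked vectors `(x, z)`, each indexed by `Fin N × Fin n`. -/

/-- `K` is the (Laplacian) matrix of a weighted undirected graph with underlying graph `G`. -/
structure IsNetworkMatrix {N : ℕ} (G : SimpleGraph (Fin N)) (K : Matrix (Fin N) (Fin N) ℝ) :
    Prop where
  isSymm : K.IsSymm
  colSum : (fun _ => (1 : ℝ)) ᵥ* K = 0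
  support : ∀ i j, i ≠ j → (K i j ≠ 0 ↔ G.Adj i j)
  spectralRadius_lt_one : spectralRadius ℝ K < 1

/-- `diag(Q₁, …, Q_N)`. -/
def stackedHessian {N n : ℕ} (Q : Fin N → Matrix (Fin n) (Fin n) ℝ) :
    Matrix (Fin N × Fin n) (Fin N × Fin n) ℝ :=
  Matrix.of fun p q => if p.1 = q.1 then Q p.1 p.2 q.2 else 0

/-- The matrix extracting the `ℝⁿ`-component of agent `i` from a stacked vector. -/
def agentSelector {N : ℕ} (n : ℕ) (i : Fin N) : Matrix (Fin n) (Fin N × Fin n) ℝ :=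
  Matrix.of fun c p => if p.1 = i ∧ p.2 = c then 1 else 0

/-- `A = [I - K - αQ, -K; K, I]`, with `K` acting as `K ⊗ Iₙ`. -/
def wangEliaA {N n : ℕ} (K : Matrix (Fin N) (Fin N) ℝ) (α : ℝ)
    (Q : Fin N → Matrix (Fin n) (Fin n) ℝ) :
    Matrix ((Fin N × Fin n) ⊕ (Fin N × Fin n)) ((Fin N × Fin n) ⊕ (Fin N × Fin n)) ℝ :=
  Matrix.fromBlocks
    (1 - K ⊗ₖ (1 : Matrix (Fin n) (Fin n) ℝ) - α • stackedHessian Q)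
    (-(K ⊗ₖ (1 : Matrix (Fin n) (Fin n) ℝ)))
    (K ⊗ₖ (1 : Matrix (Fin n) (Fin n) ℝ))
    1

/-- The attack input enters both the `x`- and the `z`-state of the malicious agent `a`. -/
def wangEliaB {N : ℕ} (n : ℕ) (a : Fin N) :
    Matrix ((Fin N × Fin n) ⊕ (Fin N × Fin n)) (Fin n) ℝ :=
  Matrix.fromRows (agentSelector n a)ᵀ (agentSelector n a)ᵀ

/-- Monitor output `W (x_m, z_m)`, `W = diag(1 - w₁, …, 1 - wₙ, w₁, …, wₙ)`. -/
def monitorC {N n : ℕ} (m : Fin N) (w : Fin n → ℝ) :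
    Matrix (Fin n ⊕ Fin n) ((Fin N × Fin n) ⊕ (Fin N × Fin n)) ℝ :=
  Matrix.diagonal (Sum.elim (fun c => 1 - w c) w) *
    Matrix.fromBlocks (agentSelector n m) 0 0 (agentSelector n m)

/-- Performance output: the stacked differences `x_i - x_{i+1}` of consecutive agents. -/
def performanceC (N n : ℕ) :
    Matrix (Fin (N - 1) × Fin n) ((Fin N × Fin n) ⊕ (Fin N × Fin n)) ℝ :=
  Matrix.fromCols
    (Matrix.of fun r p =>
      if p.2 = r.2 then
        (if (p.1 : ℕ) = (r.1 : ℕ) then 1 else 0) - (if (p.1 : ℕ) = (r.1 : ℕ) + 1 then 1 else 0)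
      else 0)
    0

/-- The number `δ_m - δ_p` of delays put on the performance output. (The attack reaches the
`x`-state in one step, so `δ_p = 1 ≤ δ_m` as soon as `2 ≤ N` and `1 ≤ n`; the truncated
subtraction is then the true difference.) -/
def outputDelay {N n : ℕ} (K : Matrix (Fin N) (Fin N) ℝ) (α : ℝ)
    (Q : Fin N → Matrix (Fin n) (Fin n) ℝ) (a m : Fin N) (w : Fin n → ℝ) : ℕ :=
  relativeDegree (wangEliaA K α Q) (wangEliaB n a) (monitorC m w) -
    relativeDegree (wangEliaA K α Q) (wangEliaB n a) (performanceC N n)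

/-- Value of the security-metric SDP, without definiteness constraint on `P`, for the closed loop
with monitor output `y_m[k]` and delayed performance output `y_p[k - (δ_m - δ_p)]`. -/
def securityValue {N n : ℕ} (K : Matrix (Fin N) (Fin N) ℝ) (α : ℝ)
    (Q : Fin N → Matrix (Fin n) (Fin n) ℝ) (a m : Fin N) (w : Fin n → ℝ) (ε : ℝ) : EReal :=
  sdpValue
    (delayA (outputDelay K α Q a m w) (wangEliaA K α Q))
    (delayB (outputDelay K α Q a m w) (wangEliaB n a))
    (delayC (outputDelay K α Q a m w) (performanceC N n))
    (currentC (outputDelay K α Q a m w) (monitorC m w))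
    ε

end WangElia

end

open scoped InnerProductSpace ComplexConjugate Topology ComplexOrder

/-! The value is at least 0 because `ε > 0` and `γ ≥ 0`, so finiteness amounts to feasibility. With
`P` of free sign, feasibility is a frequency condition on the unit circle alone: zeros off the
circle, stable or not, do no harm.

Write `E = [A B]`, `J = [I 0]`, and `T = CpᵀCp - γ CmᵀCm` with both outputs extended by zero on the
input. If no zero of the monitor system has modulus one, then `Cm v ≠ 0` whenever `E v = λ J v`,
`|λ| = 1`, `v ≠ 0`. By compactness a single large `γ` makes `v* T v < 0` for all such `v`.

A strict KYP lemma then yields `P`. Otherwise Hahn–Banach gives a nonzero `Z ⪰ 0` with `E Z Eᵀ = J Z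
Jᵀ` and `tr(T Z) ≥ 0`. Factoring `Z = W W*` gives `E W = J W U` with `U` unitary. Diagonalising `U`
splits `tr(T Z)` into terms `v* T v` with `E v = λ J v`, `|λ| = 1`, which forces `Z = 0`, a
contradiction.

Delaying the performance output adds no nonzero zeros to the monitor system, so the hypothesis on
its zeros carries over to the augmented system for any delay. -/

/-! ### Isometries and pairs of matrices with `M M* = M' M'*`. -/

theorem LinearIsometry.exists_orthonormalBasis_eigenvectors {E : Type*} [NormedAddCommGroup E]
    [InnerProductSpace ℂ E] [FiniteDimensional ℂ E] (U : E →ₗᵢ[ℂ] E) :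
    ∃ (b : OrthonormalBasis (Fin (Module.finrank ℂ E)) ℂ E)
      (c : Fin (Module.finrank ℂ E) → ℂ), ∀ i, ‖c i‖ = 1 ∧ U (b i) = c i • b i := by
  classical
  set T : Module.End ℂ E := U.toLinearMap with hTdef
  have hT : ∀ v, T v = U v := fun _ => rfl
  have hnorm : ∀ (μ : ℂ) (v : E), v ≠ 0 → U v = μ • v → ‖μ‖ = 1 := by
    intro μ v hv h
    have h1 : ‖v‖ = ‖μ‖ * ‖v‖ := by rw [← norm_smul, ← h, U.norm_map]
    have h2 : ‖v‖ ≠ 0 := norm_ne_zero_iff.2 hv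
    exact (mul_right_cancel₀ h2 (by rw [one_mul]; exact h1)).symm
  have hconj : ∀ (μ : ℂ), ‖μ‖ = 1 → conj μ * μ = 1 := by
    intro μ h
    rw [mul_comm, Complex.mul_conj, Complex.normSq_eq_norm_sq, h]; simp
  have horth : OrthogonalFamily ℂ (fun μ => Module.End.eigenspace T μ)
      fun μ => (Module.End.eigenspace T μ).subtypeₗᵢ := by
    rintro μ ν hμν ⟨v, hv⟩ ⟨w, hw⟩
    rw [Module.End.mem_eigenspace_iff, hT] at hv hw
    change ⟪v, w⟫_ℂ = 0
    by_cases hv' : v = 0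
    · simp [hv']
    have h1 := U.inner_map_map v w
    rw [hv, hw, inner_smul_left, inner_smul_right] at h1
    have h2 := hconj μ (hnorm μ v hv' hv)
    by_contra h0
    have h3 : conj μ * ν = 1 := mul_right_cancel₀ h0 (by rw [mul_assoc, h1, one_mul])
    have hc : conj μ ≠ 0 := fun h => by simp [h] at h2
    exact hμν (mul_left_cancel₀ hc (h2.trans h3.symm))
  -- If `U w = μ w` and `v ⊥ w`, then `conj μ * ⟪w, U v⟫ = ⟪U w, U v⟫ = ⟪w, v⟫ = 0`. Hence the
  -- complement of the eigenspaces is invariant, and if nonzero it would contain a further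
  -- eigenvector.
  have hinv : ∀ v ∈ (⨆ μ, Module.End.eigenspace T μ)ᗮ,
      T v ∈ (⨆ μ, Module.End.eigenspace T μ)ᗮ := by
    rw [← Submodule.iInf_orthogonal]
    intro v hv
    rw [Submodule.mem_iInf] at hv ⊢
    intro μ w hw
    rw [Module.End.mem_eigenspace_iff, hT] at hw
    by_cases hw' : w = 0
    · simp [hw']
    have h1 := U.inner_map_map w v
    rw [hw, inner_smul_left, hv μ w (by rw [Module.End.mem_eigenspace_iff, hT, hw])] at h1
    have h2 := hconj μ (hnorm μ w hw' hw)
    have hc : conj μ ≠ 0 := fun h => by simp [h] at h2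
    exact (mul_eq_zero.1 h1).resolve_left hc
  have hbot : (⨆ μ, Module.End.eigenspace T μ)ᗮ = ⊥ := by
    by_contra hne
    have : Nontrivial ↥(⨆ μ, Module.End.eigenspace T μ)ᗮ :=
      Submodule.nontrivial_iff_ne_bot.2 hne
    obtain ⟨μ, hμ⟩ := Module.End.exists_eigenvalue (T.restrict hinv)
    obtain ⟨v, hv⟩ := hμ.exists_hasEigenvector
    have hv1 : T v = μ • (v : E) := congrArg Subtype.val hv.apply_eq_smul
    have hv2 : (v : E) ∈ ⨆ μ, Module.End.eigenspace T μ :=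
      Submodule.mem_iSup_of_mem μ (Module.End.mem_eigenspace_iff.2 hv1)
    have hv3 := v.2 _ hv2
    exact hv.2 (Subtype.ext (inner_self_eq_zero.1 hv3))
  have hint : DirectSum.IsInternal fun μ : Module.End.Eigenvalues T =>
      Module.End.eigenspace T μ := by
    refine (OrthogonalFamily.isInternal_iff (horth.comp Subtype.coe_injective)).2 ?_
    change (⨆ μ : { μ // Module.End.eigenspace T μ ≠ ⊥ }, Module.End.eigenspace T μ)ᗮ = ⊥
    rw [iSup_ne_bot_subtype, hbot]
  have hb := hint.subordinateOrthonormalBasis_subordinate rfl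
  refine ⟨hint.subordinateOrthonormalBasis rfl (horth.comp Subtype.coe_injective), fun i =>
    (hint.subordinateOrthonormalBasisIndex rfl i (horth.comp Subtype.coe_injective) :
      Module.End.Eigenvalues T).1, fun i => ?_⟩
  have h1 := Module.End.mem_eigenspace_iff.1 (hb i (horth.comp Subtype.coe_injective))
  refine ⟨hnorm _ _ ?_ h1, h1⟩
  exact (OrthonormalBasis.orthonormal _).ne_zero i

/-- The rule `g w ↦ f w` is well defined and isometric on the range of `g` because the norms agree;
finite dimension lets it extend to all of `E`. -/
theorem LinearMap.exists_linearIsometry_comp_eq {W E : Type*} [AddCommGroup W] [Module ℂ W]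
    [NormedAddCommGroup E] [InnerProductSpace ℂ E] [FiniteDimensional ℂ E]
    (f g : W →ₗ[ℂ] E) (h : ∀ w, ‖f w‖ = ‖g w‖) :
    ∃ U : E →ₗᵢ[ℂ] E, ∀ w, f w = U (g w) := by
  obtain ⟨s, hs⟩ := g.rangeRestrict.exists_rightInverse_of_surjective
    (LinearMap.range_eq_top.2 g.surjective_rangeRestrict)
  have hs' : ∀ y : LinearMap.range g, g (s y) = y := fun y =>
    congrArg Subtype.val (LinearMap.congr_fun hs y)
  let L : LinearMap.range g →ₗᵢ[ℂ] E :=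
    { toLinearMap := f ∘ₗ s
      norm_map' := fun y => by
        rw [LinearMap.comp_apply, h, hs']; rfl }
  refine ⟨L.extend, fun w => ?_⟩
  have h1 := L.extend_apply ⟨g w, LinearMap.mem_range_self g w⟩
  rw [h1]
  change f w = f (s ⟨g w, _⟩)
  rw [← sub_eq_zero, ← map_sub, ← norm_eq_zero, h, map_sub, hs', sub_self, norm_zero]

/-- Equal products give `‖M* w‖ = ‖M'* w‖`, so `M* = U M'*` with `U` an isometry, i.e. `M = M' U*`.
On an eigenvector of `U` with eigenvalue `c`, `U*` acts as `c⁻¹`. -/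
theorem Matrix.exists_orthonormalBasis_mulVec_eq_smul {σ κ : Type*} [Fintype σ] [Fintype κ]
    [DecidableEq σ] [DecidableEq κ] (M M' : Matrix σ κ ℂ) (h : M * Mᴴ = M' * M'ᴴ) :
    ∃ (d : ℕ) (b : OrthonormalBasis (Fin d) ℂ (EuclideanSpace ℂ κ)) (c : Fin d → ℂ),
      ∀ i, ‖c i‖ = 1 ∧ M *ᵥ (b i).ofLp = c i • (M' *ᵥ (b i).ofLp) := by
  have hsq : ∀ (X : Matrix σ κ ℂ) (w : EuclideanSpace ℂ σ),
      ⟪Matrix.toEuclideanLin Xᴴ w, Matrix.toEuclideanLin Xᴴ w⟫_ℂ =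
        ⟪Matrix.toEuclideanLin (X * Xᴴ) w, w⟫_ℂ := by
    intro X w
    rw [Matrix.toEuclideanLin_conjTranspose_eq_adjoint, LinearMap.adjoint_inner_right,
      ← Matrix.toEuclideanLin_conjTranspose_eq_adjoint]
    congr 1
    simp [Matrix.toLpLin_apply]
  have hnorm : ∀ w : EuclideanSpace ℂ σ,
      ‖Matrix.toEuclideanLin Mᴴ w‖ = ‖Matrix.toEuclideanLin M'ᴴ w‖ := by
    intro w
    rw [@norm_eq_sqrt_re_inner ℂ, @norm_eq_sqrt_re_inner ℂ, hsq, hsq, h]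
  obtain ⟨U, hU⟩ := LinearMap.exists_linearIsometry_comp_eq _ _ hnorm
  obtain ⟨b, c, hbc⟩ := U.exists_orthonormalBasis_eigenvectors
  refine ⟨_, b, fun i => (c i)⁻¹, fun i => ⟨by rw [norm_inv, (hbc i).1, inv_one], ?_⟩⟩
  have hc : c i ≠ 0 := norm_ne_zero_iff.1 (by rw [(hbc i).1]; exact one_ne_zero)
  have key : Matrix.toEuclideanLin M (b i) = (c i)⁻¹ • Matrix.toEuclideanLin M' (b i) := by
    refine ext_inner_left ℂ fun y => ?_
    rw [inner_smul_right, ← LinearMap.adjoint_inner_left, ← LinearMap.adjoint_inner_left,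
      ← Matrix.toEuclideanLin_conjTranspose_eq_adjoint,
      ← Matrix.toEuclideanLin_conjTranspose_eq_adjoint, hU,
      ← U.inner_map_map (Matrix.toEuclideanLin M'ᴴ y) (b i), (hbc i).2, inner_smul_right,
      inv_mul_cancel_left₀ hc]
  exact congrArg WithLp.ofLp key

/-! ### The strict KYP lemma by duality. -/

-- The dual half of the KYP lemma. With `Z = W W*`, the previous lemma applied to `E W` and `J W`
-- gives an orthonormal basis `b` such that each `W bᵢ` satisfies the pencil equation at a point of
-- the unit circle. As `tr(T Z)` is the sum of the forms of `T` at the `W bᵢ`, its nonnegativity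
-- forces every `W bᵢ` to vanish.
open scoped MatrixOrder in
theorem Matrix.PosSemidef.eq_zero_of_trace_mul_nonneg {σ κ : Type*} [Fintype σ] [Fintype κ]
    [DecidableEq σ] [DecidableEq κ] {E J : Matrix σ κ ℝ} {T Z : Matrix κ κ ℝ}
    (hZ : Z.PosSemidef) (hEJ : E * Z * Eᵀ = J * Z * Jᵀ)
    (hneg : ∀ lam : ℂ, ‖lam‖ = 1 → ∀ v : κ → ℂ, v ≠ 0 →
      E.map Complex.ofReal *ᵥ v = lam • (J.map Complex.ofReal *ᵥ v) →
      (star v ⬝ᵥ T.map Complex.ofReal *ᵥ v).re < 0)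
    (htr : 0 ≤ (T * Z).trace) : Z = 0 := by
  obtain ⟨B, rfl⟩ := CStarAlgebra.nonneg_iff_eq_star_mul_self.mp hZ.nonneg
  rw [Matrix.star_eq_conjTranspose, Matrix.conjTranspose_eq_transpose_of_trivial] at *
  set φ := Complex.ofRealHom
  set W : Matrix κ κ ℂ := (Bᵀ).map φ with hW
  have hWH : Wᴴ = B.map φ := by rw [hW]; ext i j; simp [φ]
  have hEH : (E.map φ)ᴴ = Eᵀ.map φ := by ext i j; simp [φ]
  have hJH : (J.map φ)ᴴ = Jᵀ.map φ := by ext i j; simp [φ]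
  have hM : (E.map φ * W) * (E.map φ * W)ᴴ = (J.map φ * W) * (J.map φ * W)ᴴ := by
    rw [Matrix.conjTranspose_mul, Matrix.conjTranspose_mul, hWH, hEH, hJH, hW]
    simp only [← Matrix.map_mul]
    congr 1
    simpa only [Matrix.mul_assoc] using hEJ
  obtain ⟨d, b, c, hbc⟩ := Matrix.exists_orthonormalBasis_mulVec_eq_smul _ _ hM
  have htrace : (((T * (Bᵀ * B)).trace : ℝ) : ℂ) =
      ∑ i, star (W *ᵥ (b i).ofLp) ⬝ᵥ T.map φ *ᵥ (W *ᵥ (b i).ofLp) := by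
    have h1 := LinearMap.trace_eq_sum_inner (Matrix.toEuclideanLin (Wᴴ * T.map φ * W)) b
    have h2 : (((T * (Bᵀ * B)).trace : ℝ) : ℂ) = (Wᴴ * T.map φ * W).trace := by
      rw [hWH, hW, ← Matrix.map_mul, ← Matrix.map_mul, ← Matrix.mul_assoc, Matrix.trace_mul_comm,
        ← Matrix.mul_assoc]
      exact map_sum φ _ _
    have h3 : LinearMap.trace ℂ _ (Matrix.toEuclideanLin (Wᴴ * T.map φ * W)) =
        (Wᴴ * T.map φ * W).trace := by
      rw [Matrix.toEuclideanLin_eq_toLin_orthonormal, Matrix.trace_toLin_eq]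
    rw [h2, ← h3, h1]
    refine Finset.sum_congr rfl fun i _ => ?_
    rw [EuclideanSpace.inner_eq_star_dotProduct, Matrix.star_mulVec, ← Matrix.dotProduct_mulVec,
      dotProduct_comm]
    simp [Matrix.toLpLin_apply, Matrix.mulVec_mulVec, Matrix.mul_assoc]
  have hle : ∀ i, W *ᵥ (b i).ofLp ≠ 0 →
      (star (W *ᵥ (b i).ofLp) ⬝ᵥ T.map φ *ᵥ (W *ᵥ (b i).ofLp)).re < 0 := by
    intro i hi
    refine hneg (c i) (hbc i).1 _ hi ?_
    have := (hbc i).2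
    rw [Matrix.mulVec_mulVec, Matrix.mulVec_mulVec]
    exact this
  have hle' : ∀ i, (star (W *ᵥ (b i).ofLp) ⬝ᵥ T.map φ *ᵥ (W *ᵥ (b i).ofLp)).re ≤ 0 := by
    intro i
    by_cases hi : W *ᵥ (b i).ofLp = 0
    · simp [hi]
    · exact (hle i hi).le
  have hsum : ∑ i, (star (W *ᵥ (b i).ofLp) ⬝ᵥ T.map φ *ᵥ (W *ᵥ (b i).ofLp)).re =
      (T * (Bᵀ * B)).trace := by
    rw [← Complex.re_sum, ← htrace, Complex.ofReal_re]
  have hzero : ∀ i, W *ᵥ (b i).ofLp = 0 := by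
    intro i
    by_contra hi
    have : ∑ i, (star (W *ᵥ (b i).ofLp) ⬝ᵥ T.map φ *ᵥ (W *ᵥ (b i).ofLp)).re < 0 :=
      Finset.sum_neg' (fun i _ => hle' i) ⟨i, Finset.mem_univ i, hle i hi⟩
    linarith
  have hW0 : Matrix.toEuclideanLin W = 0 := by
    refine b.toBasis.ext fun i => ?_
    rw [b.coe_toBasis, LinearMap.zero_apply]
    exact congrArg (WithLp.toLp 2) (hzero i)
  have hW0' : W = 0 := by simpa using hW0
  have hB : Bᵀ = 0 := by
    ext i j
    have := congrFun (congrFun hW0' i) j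
    simpa [hW, φ] using this
  rw [hB, zero_mul]

theorem nonpos_of_forall_pos_mul_le {x y : ℝ} (h : ∀ t : ℝ, 0 < t → t * x ≤ y) : x ≤ 0 := by
  by_contra! hx
  have h1 := h ((|y| + 1) / x) (by positivity)
  rw [div_mul_cancel₀ _ hx.ne'] at h1
  linarith [le_abs_self y]

theorem le_of_forall_pos_le_add_mul {x y z : ℝ} (h : ∀ t : ℝ, 0 < t → x ≤ y + t * z) :
    x ≤ y := by
  by_contra! hx
  have hz : 0 < |z| + 1 := by positivity
  have h1 := h ((x - y) / (2 * (|z| + 1))) (by apply div_pos <;> linarith)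
  have h2 : (x - y) / (2 * (|z| + 1)) * z ≤ (x - y) / (2 * (|z| + 1)) * (|z| + 1) :=
    mul_le_mul_of_nonneg_left (by linarith [le_abs_self z]) (by apply div_nonneg <;> linarith)
  have h3 : (x - y) / (2 * (|z| + 1)) * (|z| + 1) = (x - y) / 2 := by
    field_simp
  linarith

theorem LinearMap.exists_forall_eq_trace_mul {κ : Type*} [Fintype κ] [DecidableEq κ]
    (f : Matrix κ κ ℝ →ₗ[ℝ] ℝ) : ∃ F : Matrix κ κ ℝ, ∀ X, f X = (X * F).trace := by
  refine ⟨Matrix.of fun i j => f (Matrix.single j i 1), fun X => ?_⟩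
  conv_lhs => rw [Matrix.matrix_eq_sum_single X]
  simp only [map_sum, Matrix.trace, Matrix.diag_apply, Matrix.mul_apply, Matrix.of_apply]
  refine Finset.sum_congr rfl fun i _ => Finset.sum_congr rfl fun j _ => ?_
  rw [← smul_eq_mul, ← map_smul, Matrix.smul_single, smul_eq_mul, mul_one]

theorem Matrix.isOpen_setOf_forall_dotProduct_mulVec_neg {κ : Type*} [Fintype κ] :
    IsOpen {X : Matrix κ κ ℝ | ∀ v : κ → ℝ, v ≠ 0 → v ⬝ᵥ X *ᵥ v < 0} := by
  rw [isOpen_iff_eventually]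
  intro X hX
  have h1 : ∀ᶠ Y in 𝓝 X, ∀ v ∈ Metric.sphere (0 : κ → ℝ) 1, v ⬝ᵥ Y *ᵥ v < 0 := by
    refine (isCompact_sphere _ _).eventually_forall_of_forall_eventually fun v hv => ?_
    have hc : Continuous fun z : Matrix κ κ ℝ × (κ → ℝ) => z.2 ⬝ᵥ z.1 *ᵥ z.2 := by fun_prop
    refine hc.continuousAt.eventually_lt continuousAt_const (hX v ?_)
    rintro rfl
    simp at hv
  filter_upwards [h1] with Y hY v hv
  have hv' : 0 < ‖v‖ := norm_pos_iff.2 hv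
  have h2 := hY (‖v‖⁻¹ • v) (by simp [norm_smul, hv'.ne'])
  rw [Matrix.mulVec_smul, smul_dotProduct, dotProduct_smul, smul_eq_mul, smul_eq_mul] at h2
  by_contra! h3
  have : 0 ≤ ‖v‖⁻¹ * (‖v‖⁻¹ * (v ⬝ᵥ Y *ᵥ v)) := by positivity
  linarith

theorem Matrix.convex_setOf_forall_dotProduct_mulVec_neg {κ : Type*} [Fintype κ] :
    Convex ℝ {X : Matrix κ κ ℝ | ∀ v : κ → ℝ, v ≠ 0 → v ⬝ᵥ X *ᵥ v < 0} := by
  intro X hX Y hY s t hs ht hst v hv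
  rw [Matrix.add_mulVec, dotProduct_add, Matrix.smul_mulVec, Matrix.smul_mulVec, dotProduct_smul,
    dotProduct_smul, smul_eq_mul, smul_eq_mul]
  have h1 := hX v hv
  have h2 := hY v hv
  rcases hs.eq_or_lt with rfl | hs
  · rw [zero_add] at hst
    rw [hst]; linarith
  · nlinarith

/-- A strict discrete-time Kalman–Yakubovich–Popov lemma, without controllability: the multiplier
inequality on the unit circle is certified by a symmetric, possibly indefinite, matrix. -/
theorem Matrix.exists_isSymm_posSemidef_of_forall_norm_eq_one {σ κ : Type*} [Fintype σ] [Fintype κ]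
    [DecidableEq σ] [DecidableEq κ] (E J : Matrix σ κ ℝ) {T : Matrix κ κ ℝ} (hT : T.IsSymm)
    (hneg : ∀ lam : ℂ, ‖lam‖ = 1 → ∀ v : κ → ℂ, v ≠ 0 →
      E.map Complex.ofReal *ᵥ v = lam • (J.map Complex.ofReal *ᵥ v) →
      (star v ⬝ᵥ T.map Complex.ofReal *ᵥ v).re < 0) :
    ∃ P : Matrix σ σ ℝ, P.IsSymm ∧ (-(Eᵀ * P * E - Jᵀ * P * J + T)).PosSemidef := by
  let L : Matrix σ σ ℝ →ₗ[ℝ] Matrix κ κ ℝ :=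
    { toFun := fun P => Eᵀ * P * E - Jᵀ * P * J
      map_add' := fun P P' => by simp only [Matrix.mul_add, Matrix.add_mul]; abel
      map_smul' := fun r P => by
        simp only [Matrix.mul_smul, Matrix.smul_mul, RingHom.id_apply, smul_sub] }
  have hL : ∀ P, L P = Eᵀ * P * E - Jᵀ * P * J := fun _ => rfl
  have hLT : ∀ P, (L P)ᵀ = L Pᵀ := fun P => by
    simp [hL, Matrix.mul_assoc]
  set S := {X : Matrix κ κ ℝ | ∀ v : κ → ℝ, v ≠ 0 → v ⬝ᵥ X *ᵥ v < 0} with hS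
  -- `S` does not demand symmetry. Since `P` and `Pᵀ` give the same quadratic form, `P` may be
  -- replaced by its symmetric part.
  suffices h : ∃ P, L P + T ∈ S by
    obtain ⟨P, hP⟩ := h
    have hPT : ∀ v : κ → ℝ, v ⬝ᵥ L Pᵀ *ᵥ v = v ⬝ᵥ L P *ᵥ v := fun v => by
      rw [← hLT, Matrix.mulVec_transpose, dotProduct_comm, ← Matrix.dotProduct_mulVec]
    have hsymm : ((1 / 2 : ℝ) • (P + Pᵀ)).IsSymm := by
      rw [Matrix.IsSymm, Matrix.transpose_smul, Matrix.transpose_add, Matrix.transpose_transpose,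
        add_comm]
    refine ⟨(1 / 2 : ℝ) • (P + Pᵀ), hsymm, ?_⟩
    rw [← hL]
    refine Matrix.PosSemidef.of_dotProduct_mulVec_nonneg ?_ fun v => ?_
    · rw [Matrix.IsHermitian, Matrix.conjTranspose_eq_transpose_of_trivial, Matrix.transpose_neg,
        Matrix.transpose_add, hLT, hsymm, hT]
    · rw [star_trivial]
      by_cases hv : v = 0
      · simp [hv]
      · have h1 := hP v hv
        rw [Matrix.add_mulVec, dotProduct_add] at h1
        rw [Matrix.neg_mulVec, dotProduct_neg, map_smul, map_add, Matrix.add_mulVec,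
          Matrix.smul_mulVec, Matrix.add_mulVec, dotProduct_add, dotProduct_smul, dotProduct_add,
          hPT, smul_eq_mul]
        linarith
  by_contra! hcon
  have hconv : Convex ℝ (Set.range fun P => L P + T) := by
    rintro _ ⟨P, rfl⟩ _ ⟨P', rfl⟩ s t _ _ hst
    refine ⟨s • P + t • P', ?_⟩
    have h1 : s • T + t • T = T := by rw [← add_smul, hst, one_smul]
    simp only [map_add, map_smul, smul_add]
    nth_rewrite 1 [← h1]
    abel
  obtain ⟨f, u, hfS, hfL⟩ := geometric_hahn_banach_open
    Matrix.convex_setOf_forall_dotProduct_mulVec_neg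
    Matrix.isOpen_setOf_forall_dotProduct_mulVec_neg hconv (by
      rw [Set.disjoint_right]
      rintro _ ⟨P, rfl⟩
      exact hcon P)
  have hfL' : ∀ P, u ≤ f (L P) + f T := fun P => by
    rw [← map_add]; exact hfL _ ⟨P, rfl⟩
  -- A functional bounded below on an affine subspace vanishes on its direction.
  have hfL0 : ∀ P, f (L P) = 0 := by
    have h1 : ∀ P, -f (L P) ≤ 0 := fun P =>
      nonpos_of_forall_pos_mul_le (y := f T - u) fun t _ => by
        have := hfL' (t • P)
        rw [map_smul, map_smul, smul_eq_mul] at this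
        linarith
    intro P
    have h2 := h1 P
    have h3 := h1 (-P)
    rw [map_neg, map_neg] at h3
    linarith
  have hquad : ∀ (v x : κ → ℝ), x ⬝ᵥ Matrix.vecMulVec v v *ᵥ x = (v ⬝ᵥ x) ^ 2 := fun v x => by
    rw [Matrix.vecMulVec_mulVec, dotProduct_smul, dotProduct_comm x v]
    simp [pow_two]
  -- The matrices `-v vᵀ` only lie in the closure of `S`; the term `t • 1` pushes them inside, and
  -- letting `t` tend to 0 recovers the bounds on `u` and `f`.
  have hneg1 : ∀ (v : κ → ℝ) (t : ℝ), 0 < t → -Matrix.vecMulVec v v - t • 1 ∈ S := by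
    intro v t ht x hx
    have h1 : 0 < x ⬝ᵥ x := by simpa using Matrix.dotProduct_star_self_pos_iff.2 hx
    rw [Matrix.sub_mulVec, dotProduct_sub, Matrix.neg_mulVec, dotProduct_neg, hquad,
      Matrix.smul_mulVec, dotProduct_smul, Matrix.one_mulVec, smul_eq_mul]
    have := mul_pos ht h1
    nlinarith [sq_nonneg (v ⬝ᵥ x)]
  have hcone : ∀ X ∈ S, f X ≤ 0 := fun X hX =>
    nonpos_of_forall_pos_mul_le (y := u) fun t ht => by
      rw [← smul_eq_mul, ← map_smul]
      refine (hfS _ fun v hv => ?_).le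
      rw [Matrix.smul_mulVec, dotProduct_smul, smul_eq_mul]
      exact mul_neg_of_pos_of_neg ht (hX v hv)
  have hu : 0 ≤ u := le_of_forall_pos_le_add_mul (z := f 1) fun t ht => by
    have := hfS _ (hneg1 0 t ht)
    rw [map_sub, map_neg, map_smul] at this
    simp at this
    linarith
  have hvv : ∀ v, 0 ≤ f (Matrix.vecMulVec v v) := fun v =>
    le_of_forall_pos_le_add_mul (z := f 1) fun t ht => by
      have := hcone _ (hneg1 v t ht)
      rw [map_sub, map_neg, map_smul, smul_eq_mul] at this
      linarith
  obtain ⟨F, hF⟩ := f.toLinearMap.exists_forall_eq_trace_mul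
  simp only [ContinuousLinearMap.coe_coe] at hF
  -- The separating functional need not be symmetric; its symmetric part is the dual variable.
  set Z : Matrix κ κ ℝ := (1 / 2 : ℝ) • (F + Fᵀ) with hZ
  have hZX : ∀ X, (X * Z).trace = (f X + f Xᵀ) / 2 := fun X => by
    have : (X * Fᵀ).trace = (Xᵀ * F).trace := by
      rw [← Matrix.trace_transpose, Matrix.transpose_mul, Matrix.transpose_transpose,
        Matrix.trace_mul_comm]
    rw [hF, hF, hZ, Matrix.mul_smul, Matrix.trace_smul, Matrix.mul_add, Matrix.trace_add, this,
      smul_eq_mul]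
    ring
  have hZpsd : Z.PosSemidef := by
    refine Matrix.PosSemidef.of_dotProduct_mulVec_nonneg ?_ fun v => ?_
    · rw [Matrix.IsHermitian, Matrix.conjTranspose_eq_transpose_of_trivial, hZ,
        Matrix.transpose_smul, Matrix.transpose_add, Matrix.transpose_transpose, add_comm]
    · have h1 : star v ⬝ᵥ Z *ᵥ v = (Matrix.vecMulVec v v * Z).trace := by
        rw [Matrix.vecMulVec_mul, Matrix.trace_vecMulVec, star_trivial, Matrix.dotProduct_mulVec,
          dotProduct_comm]
      rw [h1, hZX, Matrix.transpose_vecMulVec]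
      linarith [hvv v]
  have hEJ : E * Z * Eᵀ = J * Z * Jᵀ := by
    refine Matrix.ext_iff_trace_mul_left.2 fun P => ?_
    have h1 : (L P * Z).trace = 0 := by rw [hZX, hLT, hfL0, hfL0]; simp
    have h2 : ∀ X : Matrix σ κ ℝ, (Xᵀ * P * X * Z).trace = (P * (X * Z * Xᵀ)).trace := fun X => by
      rw [Matrix.mul_assoc, Matrix.mul_assoc, Matrix.trace_mul_comm]
      simp only [Matrix.mul_assoc]
    rw [hL, Matrix.sub_mul, Matrix.trace_sub, h2, h2] at h1
    linarith
  have hfT : u ≤ f T := by simpa using hfL' 0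
  have hZ0 : Z = 0 := hZpsd.eq_zero_of_trace_mul_nonneg hEJ hneg (by
    rw [hZX, hT]; linarith)
  -- `Z = 0` makes `f` vanish on symmetric matrices, so strict separation at `-1` gives `0 < u`,
  -- against `u ≤ f T = 0`.
  have h1 := hZX T
  have h2 := hZX (-Matrix.vecMulVec 0 0 - (1 : ℝ) • 1)
  rw [hZ0, hT] at h1
  rw [hZ0] at h2
  have h3 := hfS _ (hneg1 0 1 one_pos)
  simp at h1 h2 h3
  linarith

/-! ### Choice of `γ` by compactness. -/

theorem Matrix.star_dotProduct_transpose_mul_self_mulVec {o κ : Type*} [Fintype o] [Fintype κ]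
    (C : Matrix o κ ℝ) (v : κ → ℂ) :
    star v ⬝ᵥ (Cᵀ * C).map Complex.ofReal *ᵥ v =
      star (C.map Complex.ofReal *ᵥ v) ⬝ᵥ (C.map Complex.ofReal *ᵥ v) := by
  have h1 : (Cᵀ * C).map Complex.ofReal = (C.map Complex.ofReal)ᴴ * C.map Complex.ofReal := by
    have : (C.map Complex.ofReal)ᴴ = Cᵀ.map Complex.ofReal := by ext i j; simp
    rw [this]
    exact Matrix.map_mul (f := Complex.ofRealHom)
  rw [h1, ← Matrix.mulVec_mulVec, Matrix.star_mulVec, ← Matrix.dotProduct_mulVec]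

/-- The ratio `|Cp v|² / |Cm v|²` is invariant under scaling `v` and continuous on the compact set
of pairs `(λ, v)` of norm one solving the pencil equation, hence bounded. -/
theorem Matrix.exists_forall_re_dotProduct_sub_smul_neg {σ κ o₁ o₂ : Type*} [Fintype σ]
    [Fintype κ] [Fintype o₁] [Fintype o₂] (E J : Matrix σ κ ℝ) (Cp : Matrix o₁ κ ℝ)
    (Cm : Matrix o₂ κ ℝ)
    (h : ∀ lam : ℂ, ‖lam‖ = 1 → ∀ v : κ → ℂ, v ≠ 0 →
      E.map Complex.ofReal *ᵥ v = lam • (J.map Complex.ofReal *ᵥ v) →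
      Cm.map Complex.ofReal *ᵥ v ≠ 0) :
    ∃ γ : ℝ, 0 ≤ γ ∧ ∀ lam : ℂ, ‖lam‖ = 1 → ∀ v : κ → ℂ, v ≠ 0 →
      E.map Complex.ofReal *ᵥ v = lam • (J.map Complex.ofReal *ᵥ v) →
      (star v ⬝ᵥ (Cpᵀ * Cp - γ • (Cmᵀ * Cm)).map Complex.ofReal *ᵥ v).re < 0 := by
  set qp : (κ → ℂ) → ℝ := fun v =>
    (star (Cp.map Complex.ofReal *ᵥ v) ⬝ᵥ (Cp.map Complex.ofReal *ᵥ v)).re with hqp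
  set qm : (κ → ℂ) → ℝ := fun v =>
    (star (Cm.map Complex.ofReal *ᵥ v) ⬝ᵥ (Cm.map Complex.ofReal *ᵥ v)).re with hqm
  have hqpc : Continuous qp := by fun_prop
  have hqmc : Continuous qm := by fun_prop
  have hpos : ∀ lam : ℂ, ‖lam‖ = 1 → ∀ v : κ → ℂ, v ≠ 0 →
      E.map Complex.ofReal *ᵥ v = lam • (J.map Complex.ofReal *ᵥ v) → 0 < qm v :=
    fun lam hl v hv he =>
      (Complex.pos_iff.1 (Matrix.dotProduct_star_self_pos_iff.2 (h lam hl v hv he))).1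
  have hqps : ∀ (r : ℝ) (v : κ → ℂ), qp ((r : ℂ) • v) = r ^ 2 * qp v := fun r v => by
    simp [hqp, Matrix.mulVec_smul, star_smul, pow_two, mul_assoc]
  have hqms : ∀ (r : ℝ) (v : κ → ℂ), qm ((r : ℂ) • v) = r ^ 2 * qm v := fun r v => by
    simp [hqm, Matrix.mulVec_smul, star_smul, pow_two, mul_assoc]
  let S : Set (ℂ × (κ → ℂ)) := (Metric.sphere 0 1 ×ˢ Metric.sphere 0 1) ∩
    {p | E.map Complex.ofReal *ᵥ p.2 = p.1 • (J.map Complex.ofReal *ᵥ p.2)}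
  have hS : IsCompact S := by
    refine ((isCompact_sphere _ _).prod (isCompact_sphere _ _)).inter_right ?_
    exact isClosed_eq (by fun_prop) (by fun_prop)
  have hSpos : ∀ p ∈ S, 0 < qm p.2 := by
    rintro ⟨lam, v⟩ ⟨⟨hl, hv⟩, he⟩
    refine hpos lam (by simpa using hl) v ?_ he
    rintro rfl
    simp at hv
  obtain ⟨c, hc⟩ := hS.exists_bound_of_continuousOn (f := fun p => qp p.2 / qm p.2)
    (ContinuousOn.div (by fun_prop) (by fun_prop) fun p hp => (hSpos p hp).ne')
  -- The extra 1 makes the inequality strict, since `qm v > 0`.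
  refine ⟨|c| + 1, by positivity, fun lam hl v hv he => ?_⟩
  have hsplit : (star v ⬝ᵥ
      (Cpᵀ * Cp - (|c| + 1) • (Cmᵀ * Cm)).map Complex.ofReal *ᵥ v).re =
      qp v - (|c| + 1) * qm v := by
    have h1 : (Cpᵀ * Cp - (|c| + 1) • (Cmᵀ * Cm)).map Complex.ofReal =
        (Cpᵀ * Cp).map Complex.ofReal - ((|c| + 1 : ℝ) : ℂ) • (Cmᵀ * Cm).map Complex.ofReal := by
      ext i j
      simp
    rw [h1, Matrix.sub_mulVec, dotProduct_sub, Matrix.smul_mulVec, dotProduct_smul,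
      Matrix.star_dotProduct_transpose_mul_self_mulVec,
      Matrix.star_dotProduct_transpose_mul_self_mulVec, Complex.sub_re, smul_eq_mul,
      Complex.re_ofReal_mul]
  rw [hsplit]
  have hv' : 0 < ‖v‖ := norm_pos_iff.2 hv
  have hmem : (lam, ((‖v‖⁻¹ : ℝ) : ℂ) • v) ∈ S := by
    refine ⟨⟨by simpa using hl, by simp [norm_smul, hv'.ne']⟩, ?_⟩
    change E.map Complex.ofReal *ᵥ _ = lam • (J.map Complex.ofReal *ᵥ _)
    rw [Matrix.mulVec_smul, Matrix.mulVec_smul, he, smul_comm]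
  have h2 := hc _ hmem
  have h3 := hpos lam hl v hv he
  rw [Real.norm_eq_abs] at h2
  have h4 := (le_abs_self _).trans (h2.trans (le_abs_self c))
  simp only [hqps, hqms] at h4
  rw [mul_div_mul_left _ _ (by positivity), div_le_iff₀ h3] at h4
  linarith

/-! ### Finiteness of the SDP value without zeros on the unit circle. -/

theorem dissipationMatrix_eq {σ ι o₁ o₂ : Type*} [Fintype σ] [DecidableEq σ] [Fintype o₁]
    [Fintype o₂] (A : Matrix σ σ ℝ) (B : Matrix σ ι ℝ) (Cp : Matrix o₁ σ ℝ)
    (Cm : Matrix o₂ σ ℝ) (γ : ℝ) (P : Matrix σ σ ℝ) :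
    dissipationMatrix A B Cp Cm γ P =
      (Matrix.fromCols A B)ᵀ * P * Matrix.fromCols A B -
        (Matrix.fromCols 1 (0 : Matrix σ ι ℝ))ᵀ * P * Matrix.fromCols 1 (0 : Matrix σ ι ℝ) +
        ((Matrix.fromCols Cp (0 : Matrix o₁ ι ℝ))ᵀ * Matrix.fromCols Cp (0 : Matrix o₁ ι ℝ) -
          γ • ((Matrix.fromCols Cm (0 : Matrix o₂ ι ℝ))ᵀ *
            Matrix.fromCols Cm (0 : Matrix o₂ ι ℝ))) := by
  ext (i | i) (j | j) <;>
    simp [dissipationMatrix, Matrix.transpose_fromCols, Matrix.fromRows_mul, Matrix.mul_fromCols,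
      add_sub_assoc]

theorem fromCols_map_mulVec {σ ι o : Type*} [Fintype σ] [Fintype ι] (X : Matrix o σ ℝ)
    (Y : Matrix o ι ℝ) (v : σ ⊕ ι → ℂ) :
    (Matrix.fromCols X Y).map Complex.ofReal *ᵥ v =
      X.map Complex.ofReal *ᵥ (v ∘ Sum.inl) + Y.map Complex.ofReal *ᵥ (v ∘ Sum.inr) := by
  ext i
  simp [Matrix.mulVec, dotProduct, Fintype.sum_sum_type]

theorem sdpValue_eq_coe_of_forall_not_isInvariantZero {σ ι o₁ o₂ : Type*} [Fintype σ]
    [DecidableEq σ] [Fintype ι] [DecidableEq ι] [Fintype o₁] [Fintype o₂] (A : Matrix σ σ ℝ)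
    (B : Matrix σ ι ℝ) (Cp : Matrix o₁ σ ℝ) (Cm : Matrix o₂ σ ℝ) {ε : ℝ} (hε : 0 < ε)
    (h : ∀ lam : ℂ, ‖lam‖ = 1 → ¬IsInvariantZero A B Cm lam) :
    ∃ v : ℝ, 0 ≤ v ∧ sdpValue A B Cp Cm ε = (v : EReal) := by
  obtain ⟨γ, hγ, hneg⟩ := Matrix.exists_forall_re_dotProduct_sub_smul_neg
    (Matrix.fromCols A B) (Matrix.fromCols 1 (0 : Matrix σ ι ℝ))
    (Matrix.fromCols Cp (0 : Matrix o₁ ι ℝ)) (Matrix.fromCols Cm (0 : Matrix o₂ ι ℝ)) (by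
      intro lam hl v hv he hC
      rw [fromCols_map_mulVec] at hC
      rw [fromCols_map_mulVec, fromCols_map_mulVec] at he
      -- The pencil equation reads `A x + B u = λ x`, whereas the system matrix carries `+B`; hence
      -- `g = -u`.
      refine h lam hl ⟨Sum.elim (v ∘ Sum.inl) (-(v ∘ Sum.inr)), ?_, ?_⟩
      · intro h0
        apply hv
        ext (i | i)
        · exact congrFun h0 (Sum.inl i)
        · exact neg_eq_zero.1 (congrFun h0 (Sum.inr i))
      · have h1 : (1 : Matrix σ σ ℝ).map Complex.ofReal = 1 :=
          Matrix.map_one _ Complex.ofReal_zero Complex.ofReal_one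
        rw [Matrix.map_zero _ Complex.ofReal_zero, Matrix.zero_mulVec, add_zero] at hC
        rw [h1, Matrix.map_zero _ Complex.ofReal_zero, Matrix.zero_mulVec, add_zero, Matrix.one_mulVec] at he
        rw [systemPencil, Matrix.fromBlocks_mulVec, Sum.elim_comp_inl, Sum.elim_comp_inr, hC,
          Matrix.zero_mulVec, add_zero, Matrix.sub_mulVec, Matrix.smul_mulVec, Matrix.one_mulVec,
          ← he, Matrix.mulVec_neg]
        ext (i | i) <;> simp)
  obtain ⟨P, hP, hPsd⟩ := Matrix.exists_isSymm_posSemidef_of_forall_norm_eq_one _ _ (by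
    simp only [Matrix.IsSymm, Matrix.transpose_sub, Matrix.transpose_smul, Matrix.transpose_mul,
      Matrix.transpose_transpose]) hneg
  rw [← dissipationMatrix_eq] at hPsd
  have hle : sdpValue A B Cp Cm ε ≤ ((ε * γ : ℝ) : EReal) := sInf_le ⟨γ, P, hγ, hP, hPsd, rfl⟩
  have hge : 0 ≤ sdpValue A B Cp Cm ε := by
    refine le_sInf ?_
    rintro _ ⟨γ', P', hγ', -, -, rfl⟩
    exact_mod_cast mul_nonneg hε.le hγ'
  have hcoe := EReal.coe_toReal (x := sdpValue A B Cp Cm ε)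
    (ne_top_of_le_ne_top (EReal.coe_ne_top _) hle)
    (ne_bot_of_le_ne_bot EReal.zero_ne_bot hge)
  exact ⟨_, EReal.toReal_nonneg hge, hcoe.symm⟩

/-! ### Zeros of the delay-augmented system. -/

theorem systemPencil_mulVec_inl {σ ι o : Type*} [Fintype σ] [DecidableEq σ] [Fintype ι]
    (A : Matrix σ σ ℝ) (B : Matrix σ ι ℝ) (C : Matrix o σ ℝ) (lam : ℂ) (v : σ ⊕ ι → ℂ) (s : σ) :
    (systemPencil A B C lam *ᵥ v) (Sum.inl s) = lam * v (Sum.inl s) -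
      ∑ t, (A s t : ℂ) * v (Sum.inl t) + ∑ u, (B s u : ℂ) * v (Sum.inr u) := by
  rw [systemPencil, Matrix.fromBlocks_mulVec, Sum.elim_inl, Matrix.sub_mulVec, Matrix.smul_mulVec,
    Matrix.one_mulVec]
  rfl

theorem systemPencil_mulVec_inr {σ ι o : Type*} [Fintype σ] [DecidableEq σ] [Fintype ι]
    (A : Matrix σ σ ℝ) (B : Matrix σ ι ℝ) (C : Matrix o σ ℝ) (lam : ℂ) (v : σ ⊕ ι → ℂ) (y : o) :
    (systemPencil A B C lam *ᵥ v) (Sum.inr y) = ∑ t, (C y t : ℂ) * v (Sum.inl t) := by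
  rw [systemPencil, Matrix.fromBlocks_mulVec, Sum.elim_inr, Matrix.zero_mulVec, add_zero]
  rfl

/-- Each delayed block is `λ⁻¹` times the preceding one, so a kernel vector is determined by its
current block and input, which solve the original equations. At `λ = 0` this fails: the oldest block
is then free when `d ≥ 1`. -/
theorem IsInvariantZero.of_delay {σ ι o : Type*} [Fintype σ] [DecidableEq σ] [Fintype ι] {d : ℕ}
    {A : Matrix σ σ ℝ} {B : Matrix σ ι ℝ} {C : Matrix o σ ℝ} {lam : ℂ} (hlam : lam ≠ 0)
    (h : IsInvariantZero (delayA d A) (delayB d B) (currentC d C) lam) :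
    IsInvariantZero A B C lam := by
  obtain ⟨v, hv, h0⟩ := h
  have hcur : ∀ s, lam * v (Sum.inl (0, s)) - ∑ t, (A s t : ℂ) * v (Sum.inl (0, t)) +
      ∑ u, (B s u : ℂ) * v (Sum.inr u) = 0 := by
    intro s
    have := congrFun h0 (Sum.inl (0, s))
    rw [systemPencil_mulVec_inl, Fintype.sum_prod_type, Fin.sum_univ_succ] at this
    simpa [delayA, delayB] using this
  have hout : ∀ y, ∑ t, (C y t : ℂ) * v (Sum.inl (0, t)) = 0 := by
    intro y
    have := congrFun h0 (Sum.inr y)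
    rw [systemPencil_mulVec_inr, Fintype.sum_prod_type, Fin.sum_univ_succ] at this
    simpa [currentC] using this
  have hshift : ∀ (i : Fin d) s, lam * v (Sum.inl (i.succ, s)) = v (Sum.inl (i.castSucc, s)) := by
    intro i s
    have := congrFun h0 (Sum.inl (i.succ, s))
    have hi : ∀ j : Fin (d + 1), (j : ℕ) = i ↔ j = i.castSucc := fun j => by simp [Fin.ext_iff]
    rw [systemPencil_mulVec_inl, Fintype.sum_prod_type,
      Fintype.sum_eq_single i.castSucc fun j hj => by simp [delayA, hi, hj]] at this
    simpa [delayA, delayB, apply_ite Complex.ofReal, sub_eq_zero] using this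
  refine ⟨Sum.elim (fun s => v (Sum.inl (0, s))) (v ∘ Sum.inr), fun hv0 => hv ?_, ?_⟩
  · have hx : ∀ (i : Fin (d + 1)) s, v (Sum.inl (i, s)) = 0 := by
      intro i
      induction i using Fin.induction with
      | zero => exact fun s => congrFun hv0 (Sum.inl s)
      | succ i ih =>
        intro s
        have h1 := hshift i s
        rw [ih] at h1
        exact (mul_eq_zero.1 h1).resolve_left hlam
    ext (⟨i, s⟩ | u)
    · exact hx i s
    · exact congrFun hv0 (Sum.inr u)
  · ext (s | y)
    · rw [systemPencil_mulVec_inl]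
      exact hcur s
    · rw [systemPencil_mulVec_inr]
      exact hout y

/-! ### The Wang–Elia closed loop. -/

theorem theorem3 {N n : ℕ}
    (G : SimpleGraph (Fin N)) (hG : G.Connected)
    (K : Matrix (Fin N) (Fin N) ℝ) (hK : IsNetworkMatrix G K)
    (Q : Fin N → Matrix (Fin n) (Fin n) ℝ) (hQ : ∀ i, (Q i).PosSemidef)
    (α : ℝ) (hα : 0 < α)
    (a m : Fin N)
    (w : Fin n → ℝ) (hw : ∀ i, w i ∈ Set.Icc (0 : ℝ) 1)
    (ε : ℝ) (hε : 0 < ε)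
    (lamM lamP : ℂ)
    (hM : IsInvariantZero (wangEliaA K α Q) (wangEliaB n a) (monitorC m w) lamM)
    (hM1 : 1 < ‖lamM‖)
    (hMrest : ∀ lam : ℂ,
      IsInvariantZero (wangEliaA K α Q) (wangEliaB n a) (monitorC m w) lam →
        lam ≠ lamM → ‖lam‖ < 1)
    (hP : IsInvariantZero (wangEliaA K α Q) (wangEliaB n a) (performanceC N n) lamP)
    (hP1 : 1 < ‖lamP‖)
    (hPrest : ∀ lam : ℂ,
      IsInvariantZero (wangEliaA K α Q) (wangEliaB n a) (performanceC N n) lam →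
        lam ≠ lamP → ‖lam‖ ≤ 1)
    (hne : ‖lamM‖ ≠ ‖lamP‖) :
    ∃ v : ℝ, 0 ≤ v ∧ securityValue K α Q a m w ε = (v : EReal) := by
  refine sdpValue_eq_coe_of_forall_not_isInvariantZero _ _ _ _ hε fun lam hlam hz => ?_
  have hlam0 : lam ≠ 0 := norm_ne_zero_iff.1 (by rw [hlam]; exact one_ne_zero)
  have h1 := hMrest lam (hz.of_delay hlam0) (by rintro rfl; exact hM1.ne' hlam)
  exact h1.ne hlam
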